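/- Write $\mathbb{N}=\{0,1,2,\dots\}$ and $\mathbb{N}_+=\{1,2,\dots\}$. All graphs are finite and simple. A graph $G=(V,E)$ is an *$s$-connector* if for all disjoint $X,Y\subseteq V$ with $|X|,|Y|\ge s$ there is an edge of $G$ with one endpoint in $X$ and the other in $Y$. For graphs $H_1,\dots,H_q$, write $G\to(H_1,\dots,H_q)$ if for every colouring of the edges of $G$ with colours $1,\dots,q$ there is some $j\in\{1,\dots,q\}$ such that the graph formed by the edges of colour $j$ contains a (not necessarily induced) copy of $H_j$. For $\mathbf{m}=(m_1,\dots,m_q)\in\mathbb{N}^q$ write $\mathbf{m}K_2=(m_1K_2,\dots,m_qK_2)$, where $mK_2$ is the matching with $m$ edges (the disjoint union of $m$ copies of $K_2$). For $\mathbf{v}\in\mathbb{Z}^q$ let $(\mathbf{v})^+\in\mathbb{N}^q$ be the vector with $j$-th coordinate $\max\{v_j,0\}$. For $\mathbf{t}\in\mathbb{N}_+^q$ put $\Lambda_{\mathbf{t}}=\sum_{j=1}^q(t_j-1)$ and $\|\mathbf{t}\|_\infty=\max_j t_j$. **Lemma.** Let $q,s\ge 1$ be integers, and suppose that $\mathbf{z}=(z_1,\dots,z_q)\in\mathbb{N}^q$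 satisfies $\min_j z_j\ge s-1$ and $\|\mathbf{z}\|_1+\min_j z_j\ge (q+13)(s-1)$, where $\|\mathbf{z}\|_1=\sum_{j=1}^q z_j$. Then for all $\mathbf{t}\in\mathbb{N}_+^q$ and all $n\ge\|\mathbf{t}\|_\infty+\Lambda_{\mathbf{t}}+1$, every $s$-connector $G$ on $n$ vertices satisfies $G\to(\mathbf{t}-\mathbf{z})^+K_2$. -/

import Mathlib

/-- A graph is an `s`-connector if any two disjoint sets, each with at least `s` vertices,
are joined by an edge. -/
def IsConnector {V : Type*} (G : SimpleGraph V) (s : ℕ) : Prop :=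
  ∀ X Y : Finset V, Disjoint X Y → s ≤ X.card → s ≤ Y.card →
    ∃ x ∈ X, ∃ y ∈ Y, G.Adj x y

/-- The graph `m K₂`, the disjoint union of `m` edges: the `i`-th edge joins `(i, 0)` and
`(i, 1)`. -/
def matchingGraph (m : ℕ) : SimpleGraph (Fin m × Fin 2) where
  Adj a b := a.1 = b.1 ∧ a.2 ≠ b.2
  symm := ⟨fun _ _ h => ⟨h.1.symm, h.2.symm⟩⟩
  loopless := ⟨fun _ h => h.2 rfl⟩

/-- `G → (H₁, …, H_q)`: every colouring of the edges of `G` with `q` colours has, for some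
colour `j`, a copy (not necessarily induced) of `H_j` all of whose edges have colour `j`. -/
def RamseyArrows {V : Type*} (G : SimpleGraph V) {q : ℕ} {W : Fin q → Type*}
    (H : (j : Fin q) → SimpleGraph (W j)) : Prop :=
  ∀ c : G.EdgeLabeling (Fin q), ∃ j : Fin q, (H j).IsContained (c.labelGraph j)

/-- `v⁺`, the coordinatewise positive part of an integer vector, with values in `ℕ`. -/
def vecPosPart {q : ℕ} (v : Fin q → ℤ) : Fin q → ℕ := fun j => (max (v j) 0).toNat

/-- The smallest entry of a vector of natural numbers (of length at least `1`). -/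
noncomputable def vecMin {q : ℕ} (z : Fin q → ℕ) : ℕ := ⨅ j, z j

/-- The `ℓ₁`-norm of a vector of natural numbers. -/
def vecNormOne {q : ℕ} (z : Fin q → ℕ) : ℕ := ∑ j, z j

/-- The `ℓ_∞`-norm of a vector of natural numbers. -/
def vecNormInf {q : ℕ} (t : Fin q → ℕ) : ℕ := Finset.univ.sup t

/-- `Λ_t`, the sum of `t_j - 1` over all `j`, for a vector `t` of positive integers. -/
def vecLambda {q : ℕ} (t : Fin q → ℕ) : ℕ := ∑ j, (t j - 1)

/-! Suppose no colour `j` contains its matching. By Tutte–Berge there are sets `S j` and labellings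
`f j`, constant on the colour-`j` components off `S j`, with |S_j| + μ_j < t_j - z_j, where μ_j is
the sum of ⌊|C|/2⌋ over the classes C of `f j`. Off the union `T` of the `S j`, the connector
property says that any two disjoint `s`-sets share a class. With k = s - 1,
`card_le_sum_classMatching` gives |V \ T| ≤ ∑ μ_j + μ_i + 9k + 1 for some `i`; adding |T| ≤ ∑ |S_j|
contradicts the lower bound on `n`.

For that inequality, let the degree of an element be the number of classes of size at least 2
containing it. Since |C| ≤ 3⌊|C|/2⌋ for these, the degrees sum to at most 3 ∑ μ_j, which pays for
all elements of degree at least 3. Only O(k) elements have degree 0 or 1, unless the ground set has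
at most 2k + 1 elements or one class misses at most k of them. Elements of degree 2 are edges of a
multigraph on the classes, where two disjoint sets of classes never both span more than k edges. Up
to O(k) edges it is a star or a triangle with multiplicities (`exists_two_thirds_le_degree`), so
some class C_i contains about two thirds of these elements. Their total deficit, one each, is thus
about (3/2)|C_i|, or 3μ_i. -/

/-! ### Matchings and the Tutte–Berge formula -/

/-- An involution without fixed points on at least `2m` vertices, moving each of them to a
neighbour, gives a matching with `m` edges. -/
lemma matchingGraph_isContained_of_involution {V : Type*} [Fintype V] {F : SimpleGraph V} {m : ℕ}
    (A : Finset V) (σ : V → V) (hσA : ∀ v ∈ A, σ v ∈ A) (hσ : ∀ v ∈ A, σ (σ v) = v)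
    (hadj : ∀ v ∈ A, F.Adj v (σ v)) (hcard : 2 * m ≤ A.card) :
    (matchingGraph m).IsContained F := by
  classical
  let e := Fintype.equivFin V
  set R := A.filter fun v => e v < e (σ v) with hR
  have hAR : A ⊆ R ∪ R.image σ := by
    intro v hv
    rw [Finset.mem_union, Finset.mem_image]
    have hne : e v ≠ e (σ v) := fun h => (hadj v hv).ne (e.injective h)
    rcases lt_or_gt_of_ne hne with h | h
    · exact Or.inl (Finset.mem_filter.2 ⟨hv, h⟩)
    · exact Or.inr ⟨σ v, Finset.mem_filter.2 ⟨hσA v hv, by rwa [hσ v hv]⟩, hσ v hv⟩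
  have hRm : m ≤ R.card := by
    have h1 := Finset.card_le_card hAR
    have h2 := Finset.card_union_le R (R.image σ)
    have h3 := Finset.card_image_le (s := R) (f := σ)
    omega
  obtain ⟨R', hR'R, hR'⟩ := Finset.exists_subset_card_eq hRm
  let r : Fin m ≃ R' := (Fintype.equivFinOfCardEq (by simpa using hR')).symm
  have hrR : ∀ i, (r i : V) ∈ R := fun i => hR'R (r i).2
  have hrA : ∀ i, (r i : V) ∈ A := fun i => (Finset.mem_filter.1 (hrR i)).1
  have hrl : ∀ i, e (r i) < e (σ (r i)) := fun i => (Finset.mem_filter.1 (hrR i)).2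
  have hcross : ∀ i j, (r i : V) ≠ σ (r j) := by
    intro i j h
    have h1 := hrl i
    have h2 := hrl j
    rw [h, hσ _ (hrA j)] at h1
    exact lt_asymm h1 h2
  let φ : Fin m × Fin 2 → V := fun p => if p.2 = 0 then r p.1 else σ (r p.1)
  have hφ : Function.Injective φ := by
    rintro ⟨i, a⟩ ⟨j, b⟩ h
    have hσinj : ∀ i j, σ (r i) = σ (r j) → i = j := fun i j h => r.injective <| Subtype.ext <| by
      rw [← hσ _ (hrA i), ← hσ _ (hrA j), h]
    fin_cases a <;> fin_cases b <;> simp [φ] at h ⊢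
    · exact h
    · exact hcross _ _ h
    · exact hcross _ _ h.symm
    · exact hσinj _ _ h
  refine ⟨⟨⟨φ, ?_⟩, hφ⟩⟩
  rintro ⟨i, a⟩ ⟨j, b⟩ ⟨h1, h2⟩
  simp only at h1 h2
  subst h1
  fin_cases a <;> fin_cases b <;> simp [φ] at h2 ⊢
  · exact hadj _ (hrA i)
  · exact (hadj _ (hrA i)).symm

/-- The graph obtained from `F` by adding `d` vertices adjacent to all others. -/
def joinFin {V : Type*} (F : SimpleGraph V) (d : ℕ) : SimpleGraph (V ⊕ Fin d) where
  Adj a b := a ≠ b ∧ ∀ u v, a = Sum.inl u → b = Sum.inl v → F.Adj u v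
  symm := ⟨fun _ _ h => ⟨h.1.symm, fun u v hu hv => (h.2 v u hv hu).symm⟩⟩
  loopless := ⟨fun _ h => h.1 rfl⟩

/-- At most `d` vertices of `V` are matched to added vertices; the other `2 * m` or more are matched
among themselves by edges of `F`. -/
lemma matchingGraph_isContained_of_joinFin {V : Type*} [Fintype V] {F : SimpleGraph V} {d m : ℕ}
    (hd : 2 * m + d ≤ Fintype.card V) {M : (joinFin F d).Subgraph} (hM : M.IsPerfectMatching) :
    (matchingGraph m).IsContained F := by
  classical
  rw [SimpleGraph.Subgraph.isPerfectMatching_iff] at hM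
  choose p hp hp' using hM
  have hpp : ∀ a, p (p a) = a := fun a => (hp' _ _ (hp a).symm).symm
  set A : Finset V := Finset.univ.filter fun v => ∃ w, p (Sum.inl v) = Sum.inl w with hA
  let σ : V → V := fun v => Sum.elim id (fun _ => v) (p (Sum.inl v))
  have hσp : ∀ v ∈ A, p (Sum.inl v) = Sum.inl (σ v) := by
    intro v hv
    obtain ⟨w, hw⟩ := (Finset.mem_filter.1 hv).2
    simp [σ, hw]
  have hσp' : ∀ v ∈ A, p (Sum.inl (σ v)) = Sum.inl v := fun v hv => by
    rw [← hσp v hv, hpp]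
  have hσA : ∀ v ∈ A, σ v ∈ A := fun v hv =>
    Finset.mem_filter.2 ⟨Finset.mem_univ _, v, hσp' v hv⟩
  refine matchingGraph_isContained_of_involution A σ hσA (fun v hv => ?_) (fun v hv => ?_) ?_
  · have := hσp _ (hσA v hv)
    rw [hσp' v hv] at this
    exact (Sum.inl_injective this).symm
  · have h1 := M.adj_sub (hp (Sum.inl v))
    rw [hσp v hv] at h1
    exact h1.2 _ _ rfl rfl
  · have hc : Aᶜ.card ≤ d := by
      rw [← Fintype.card_fin d, ← Finset.card_univ]
      rw [← Finset.card_map (Function.Embedding.inr : Fin d ↪ V ⊕ Fin d)]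
      refine Finset.card_le_card_of_injOn (fun v => p (Sum.inl v)) (fun v hv => ?_)
        fun v _ w _ h => ?_
      · rcases h : p (Sum.inl v) with w | i
        · exact absurd (Finset.mem_filter.2 ⟨Finset.mem_univ _, w, h⟩)
            (Finset.mem_compl.1 (Finset.mem_coe.1 hv))
        · simp [h]
      · have h2 := congrArg p h
        simp only [hpp] at h2
        exact Sum.inl_injective h2
    rw [Finset.card_compl] at hc
    omega

/-- **Tutte–Berge formula**: a graph without a matching of `m` edges has a set `S` of vertices and
a labelling that is constant on the components of `F - S`, for which the trivial upper bound on
the number of edges of a matching is less than `m`. -/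
theorem exists_label_of_not_matchingGraph_isContained {V : Type*} [Fintype V] [DecidableEq V]
    (F : SimpleGraph V) (m : ℕ) (hm : 0 < m) (h : ¬ (matchingGraph m).IsContained F) :
    ∃ (S : Finset V) (f : V → V), (∀ u v, u ∉ S → v ∉ S → F.Adj u v → f u = f v) ∧
      S.card + ∑ x, (Finset.univ.filter fun v => v ∉ S ∧ f v = x).card / 2 < m := by
  classical
  rcases lt_or_ge (Fintype.card V) (2 * m) with hn | hn
  · rcases isEmpty_or_nonempty V with hV | ⟨⟨v₀⟩⟩
    · exact ⟨∅, id, fun u => hV.elim u, by simpa using hm⟩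
    · refine ⟨∅, fun _ => v₀, fun _ _ _ _ _ => rfl, ?_⟩
      rw [Finset.sum_eq_single v₀]
      · simp
        omega
      · intro x _ hx
        simp [hx.symm]
      · simp
  obtain ⟨d, hd⟩ := Nat.exists_eq_add_of_le hn
  have hno : ¬ ∃ M : (joinFin F d).Subgraph, M.IsPerfectMatching := fun ⟨M, hM⟩ =>
    h (matchingGraph_isContained_of_joinFin hd.ge hM)
  rw [SimpleGraph.tutte] at hno
  push Not at hno
  obtain ⟨T, hT⟩ := hno
  rw [SimpleGraph.IsTutteViolator] at hT
  set H := ((⊤ : (joinFin F d).Subgraph).deleteVerts T) with hH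
  have hverts : H.verts = Tᶜ := by simp [hH, Set.compl_eq_univ_sdiff]
  have hadj : ∀ a b : H.verts, (joinFin F d).Adj a b → H.coe.Adj a b := by
    intro a b hab
    have ha : (a : V ⊕ Fin d) ∈ Tᶜ := hverts.subset a.2
    have hb : (b : V ⊕ Fin d) ∈ Tᶜ := hverts.subset b.2
    simpa [hH, SimpleGraph.Subgraph.deleteVerts_adj, hab] using ⟨ha, hb⟩
  -- The join has `2 * (m + d)` vertices, so the number of odd components has the parity of |T|: a
  -- violation by one is a violation by two.
  have hpar : T.ncard + 2 ≤ H.coe.oddComponents.ncard := by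
    have h1 := SimpleGraph.odd_ncard_oddComponents (G := H.coe)
    have h2 : Nat.card H.verts + T.ncard = 2 * (m + d) := by
      rw [hverts, Nat.card_coe_set_eq, add_comm, Set.ncard_add_ncard_compl]
      simp [hd]
      ring
    have h3 : H.coe.oddComponents.ncard ≠ T.ncard + 1 := by
      intro h4
      rw [h4] at h1
      rcases Nat.even_or_odd T.ncard with h5 | h5
      · have := h1.1 h5.add_one
        have h6 := this.add_even h5
        rw [h2] at h6
        exact (Nat.not_odd_iff_even.2 (even_two_mul _)) h6
      · have h6 : Odd (Nat.card H.verts) := by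
          by_contra h7
          have := (Nat.not_odd_iff_even.1 h7).add_odd h5
          rw [h2] at this
          exact (Nat.not_odd_iff_even.2 (even_two_mul _)) this
        exact (Nat.not_odd_iff_even.2 h5.add_one) (h1.2 h6)
    omega
  -- An added vertex outside `T` would make the rest connected, but there are at least two odd
  -- components.
  have hinr : ∀ i : Fin d, Sum.inr i ∈ T := by
    intro i
    by_contra hi
    have hi' : Sum.inr i ∈ H.verts := by rw [hverts]; exact hi
    have : H.coe.oddComponents.ncard ≤ 1 := by
      rw [Set.ncard_le_one_iff]
      have key : ∀ c : H.coe.ConnectedComponent, c = H.coe.connectedComponentMk ⟨Sum.inr i, hi'⟩ := by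
        intro c
        induction c using SimpleGraph.ConnectedComponent.ind with
        | h a =>
          rw [SimpleGraph.ConnectedComponent.eq]
          by_cases e : a = ⟨Sum.inr i, hi'⟩
          · rw [e]
          · refine (hadj _ _ ⟨fun e' => e (Subtype.ext e'), ?_⟩).reachable
            intro u v _ hv
            cases hv
      intro a b _ _
      rw [key a, key b]
    omega
  set S : Finset V := Finset.univ.filter fun v => Sum.inl v ∈ T with hS
  have hTcard : T.ncard = S.card + d := by
    have : T = ((S.disjSum (Finset.univ : Finset (Fin d)) : Finset (V ⊕ Fin d)) : Set (V ⊕ Fin d)) := by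
      ext (v | i) <;> simp [hS, hinr]
    rw [this, Set.ncard_coe_finset, Finset.card_disjSum]
    simp
  have hmem : ∀ v, v ∉ S → Sum.inl v ∈ H.verts := by
    intro v hv
    rw [hverts]
    simpa [hS] using hv
  have hout : ∀ c : H.coe.ConnectedComponent, ∃ v, ∃ hv : v ∉ S,
      H.coe.connectedComponentMk ⟨Sum.inl v, hmem v hv⟩ = c := by
    intro c
    induction c using SimpleGraph.ConnectedComponent.ind with
    | h a =>
      obtain ⟨v | i, ha⟩ := a
      · refine ⟨v, ?_, rfl⟩
        rw [hverts] at ha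
        simpa [hS] using ha
      · rw [hverts] at ha
        exact absurd (hinr i) ha
  choose rep hrepS hrep using hout
  have hrepinj : Function.Injective rep := by
    intro c c' h
    rw [← hrep c, ← hrep c']
    simp only [h]
  let f : V → V := fun v =>
    if hv : v ∈ S then v else rep (H.coe.connectedComponentMk ⟨Sum.inl v, hmem v hv⟩)
  have hf : ∀ v (hv : v ∉ S), f v = rep (H.coe.connectedComponentMk ⟨Sum.inl v, hmem v hv⟩) :=
    fun v hv => dif_neg hv
  refine ⟨S, f, ?_, ?_⟩
  · intro u v hu hv huv
    rw [hf u hu, hf v hv]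
    congr 1
    rw [SimpleGraph.ConnectedComponent.eq]
    refine (hadj _ _ ⟨?_, ?_⟩).reachable
    · simpa using huv.ne
    · rintro a b ha hb
      rw [Sum.inl.injEq] at ha hb
      rwa [← ha, ← hb]
  set C : V → Finset V := fun x => Finset.univ.filter fun v => v ∉ S ∧ f v = x with hC
  have hsum : ∑ x, (C x).card = Fintype.card V - S.card := by
    rw [← Finset.card_compl, Finset.card_eq_sum_card_fiberwise (f := f) (t := Finset.univ)
      (fun _ _ => Finset.mem_coe.2 (Finset.mem_univ _))]
    refine Finset.sum_congr rfl fun x _ => ?_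
    congr 1
    ext v
    simp [hC]
  have hodd : H.coe.oddComponents.ncard ≤ (Finset.univ.filter fun x => Odd (C x).card).card := by
    rw [← Set.ncard_coe_finset]
    refine Set.ncard_le_ncard_of_injOn rep (fun c hc => ?_) hrepinj.injOn (Set.toFinite _)
    have hcC : c.supp.ncard = (C (rep c)).card := by
      rw [← Set.ncard_coe_finset]
      refine (Set.ncard_congr (fun v hv => (⟨Sum.inl v, hmem v ?_⟩ : H.verts)) ?_ ?_ ?_).symm
      · simp [hC] at hv
        exact hv.1
      · intro v hv
        simp only [hC, Finset.coe_filter, Finset.mem_univ, true_and, Set.mem_ofPred_eq] at hv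
        rw [SimpleGraph.ConnectedComponent.mem_supp_iff]
        exact hrepinj ((hf v hv.1).symm.trans hv.2)
      · intro v w _ _ h
        simpa using h
      · rintro ⟨v | i, ha⟩ hv
        · have hvS : v ∉ S := by
            rw [hverts] at ha
            simpa [hS] using ha
          refine ⟨v, ?_, rfl⟩
          simp only [hC, Finset.coe_filter, Finset.mem_univ, true_and, Set.mem_ofPred_eq]
          refine ⟨hvS, ?_⟩
          rw [SimpleGraph.ConnectedComponent.mem_supp_iff] at hv
          rw [hf v hvS, hv]
        · rw [hverts] at ha
          exact absurd (hinr i) ha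
    simp only [Finset.coe_filter, Finset.mem_univ, true_and, Set.mem_ofPred_eq, ← hcC]
    exact hc
  have hhalf : 2 * ∑ x, (C x).card / 2 + (Finset.univ.filter fun x => Odd (C x).card).card =
      ∑ x, (C x).card := by
    rw [Finset.card_filter, Finset.mul_sum, ← Finset.sum_add_distrib]
    refine Finset.sum_congr rfl fun x _ => ?_
    split_ifs with h1
    · rw [Nat.odd_iff] at h1
      omega
    · rw [Nat.not_odd_iff_even, Nat.even_iff] at h1
      omega
  have hSle : S.card ≤ Fintype.card V := Finset.card_le_univ S
  -- With |V| = 2m + d and at least |S| + d + 2 odd classes, |S| + (|V| - |S| - odd)/2 ≤ m - 1.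
  change S.card + ∑ x, (C x).card / 2 < m
  omega

/-! ### Weighted graphs without two heavy disjoint pieces -/

/-- The total weight `∑ c a b` of the pairs in `A × B`. -/
def pairWeight {ι : Type*} (c : ι → ι → ℕ) (A B : Finset ι) : ℕ := ∑ a ∈ A, ∑ b ∈ B, c a b

namespace pairWeight

variable {ι : Type*} (c : ι → ι → ℕ)

lemma union_left [DecidableEq ι] {A B : Finset ι} (h : Disjoint A B) (C : Finset ι) :
    pairWeight c (A ∪ B) C = pairWeight c A C + pairWeight c B C :=
  Finset.sum_union h

lemma union_right [DecidableEq ι] (C : Finset ι) {A B : Finset ι} (h : Disjoint A B) :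
    pairWeight c C (A ∪ B) = pairWeight c C A + pairWeight c C B := by
  simp only [pairWeight, Finset.sum_union h, Finset.sum_add_distrib]

lemma symm {c : ι → ι → ℕ} (hc : ∀ a b, c a b = c b a) (A B : Finset ι) :
    pairWeight c A B = pairWeight c B A := by
  unfold pairWeight
  rw [Finset.sum_comm]
  exact Finset.sum_congr rfl fun a _ => Finset.sum_congr rfl fun b _ => hc _ _

lemma mono {A A' B B' : Finset ι} (hA : A ⊆ A') (hB : B ⊆ B') :
    pairWeight c A B ≤ pairWeight c A' B' :=
  (Finset.sum_le_sum fun _ _ => Finset.sum_le_sum_of_subset hB).trans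
    (Finset.sum_le_sum_of_subset hA)

lemma union_union [DecidableEq ι] {c : ι → ι → ℕ} (hc : ∀ a b, c a b = c b a)
    {A B : Finset ι} (h : Disjoint A B) :
    pairWeight c (A ∪ B) (A ∪ B) =
      pairWeight c A A + pairWeight c B B + 2 * pairWeight c A B := by
  rw [union_left c h, union_right c _ h, union_right c _ h, symm hc B A]
  ring

end pairWeight

/-- A property of finsets that holds for the empty set holds for all of `s`, or there is a
subset of `s` with it that loses it on adding some further element of `s`. -/
lemma Finset.exists_subset_insert_not {ι : Type*} [DecidableEq ι] (p : Finset ι → Prop)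
    (hp : p ∅) (s : Finset ι) :
    p s ∨ ∃ A ⊆ s, ∃ y ∈ s, y ∉ A ∧ p A ∧ ¬ p (insert y A) := by
  induction s using Finset.induction_on with
  | empty => exact Or.inl hp
  | insert a s ha ih =>
    rcases ih with h | ⟨A, hA, y, hy, hyA, h⟩
    · by_cases h' : p (insert a s)
      · exact Or.inl h'
      · exact Or.inr ⟨s, Finset.subset_insert _ _, a, Finset.mem_insert_self _ _, ha, h, h'⟩
    · exact Or.inr ⟨A, hA.trans (Finset.subset_insert _ _), y, Finset.mem_insert_of_mem hy, hyA, h⟩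

/-- There are no two vertex-disjoint bipartite pieces inside `P × Q`
which both have weight more than `k`. -/
def NoTwoPieces {ι : Type*} (c : ι → ι → ℕ) (k : ℕ) (P Q : Finset ι) : Prop :=
  ∀ P₁ ⊆ P, ∀ P₂ ⊆ P, ∀ Q₁ ⊆ Q, ∀ Q₂ ⊆ Q, Disjoint P₁ P₂ → Disjoint Q₁ Q₂ →
    pairWeight c P₁ Q₁ ≤ k ∨ pairWeight c P₂ Q₂ ≤ k

/-- Enlarge `A ⊆ Q` until a single `y` pushes its weight to `P₁` above `k`. The rest `B` then has
weight at most `k` to `P₂`, and comparing the other disjoint pieces either bounds one `Pᵢ` or leaves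
at most `k` in each of the four pieces avoiding `y`. -/
lemma NoTwoPieces.split {ι : Type*} [DecidableEq ι] {c : ι → ι → ℕ} {k : ℕ} {P₁ P₂ Q : Finset ι}
    (hP : Disjoint P₁ P₂) (h : NoTwoPieces c k (P₁ ∪ P₂) Q) :
    pairWeight c P₁ Q ≤ 3 * k ∨ pairWeight c P₂ Q ≤ 3 * k ∨
      ∃ y ∈ Q, pairWeight c (P₁ ∪ P₂) Q ≤ pairWeight c (P₁ ∪ P₂) {y} + 4 * k := by
  rcases Finset.exists_subset_insert_not (fun A => pairWeight c P₁ A ≤ k)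
    (by simp [pairWeight]) Q with h1 | ⟨A, hA, y, hy, hyA, h1, h2⟩
  · left; omega
  set B := Q \ insert y A with hB
  have hBQ : B ⊆ Q := Finset.sdiff_subset
  have hyQ : {y} ⊆ Q := Finset.singleton_subset_iff.2 hy
  have hyAQ : insert y A ⊆ Q := Finset.insert_subset hy hA
  have hins : insert y A = {y} ∪ A := rfl
  have dyA : Disjoint {y} A := Finset.disjoint_singleton_left.2 hyA
  have dAB' : Disjoint (insert y A) B := Finset.disjoint_sdiff
  have dAB : Disjoint A B := dAB'.mono_left (Finset.subset_insert _ _)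
  have dyB : Disjoint {y} B := dAB'.mono_left (by simp)
  have hQ : Q = ({y} ∪ A) ∪ B := by
    rw [← hins, hB, Finset.union_sdiff_of_subset hyAQ]
  have e : ∀ P, pairWeight c P Q = pairWeight c P {y} + pairWeight c P A + pairWeight c P B := by
    intro P
    conv_lhs => rw [hQ]
    rw [pairWeight.union_right c _ (hins ▸ dAB'), pairWeight.union_right c _ dyA]
  have s1 : P₁ ⊆ P₁ ∪ P₂ := Finset.subset_union_left
  have s2 : P₂ ⊆ P₁ ∪ P₂ := Finset.subset_union_right
  have p1 := h P₁ s1 P₂ s2 _ hyAQ B hBQ hP dAB'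
  have p2 := h P₁ s1 P₂ s2 B hBQ A hA hP dAB.symm
  have p3 := h P₁ s1 P₂ s2 B hBQ {y} hyQ hP dyB.symm
  have p4 := h P₁ s1 P₂ s2 {y} hyQ A hA hP dyA
  have e1 := e P₁
  have e2 := e P₂
  have e3 := pairWeight.union_left c hP Q
  have e4 := pairWeight.union_left c hP {y}
  by_cases h3 : pairWeight c P₁ Q ≤ 3 * k
  · exact Or.inl h3
  by_cases h4 : pairWeight c P₂ Q ≤ 3 * k
  · exact Or.inr (Or.inl h4)
  refine Or.inr (Or.inr ⟨y, hy, ?_⟩)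
  omega

/-- Without two heavy disjoint pieces, the bipartite weight is concentrated on a star. -/
lemma NoTwoPieces.star {ι : Type*} [DecidableEq ι] {c : ι → ι → ℕ} {k : ℕ} {P Q : Finset ι}
    (h : NoTwoPieces c k P Q) :
    pairWeight c P Q ≤ 6 * k ∨
      (∃ x ∈ P, pairWeight c P Q ≤ pairWeight c {x} Q + 6 * k) ∨
      ∃ y ∈ Q, pairWeight c P Q ≤ pairWeight c P {y} + 6 * k := by
  -- The threshold `3 * k` rules out the first alternative of `NoTwoPieces.split` for `insert x A`.
  rcases Finset.exists_subset_insert_not (fun A => pairWeight c A Q ≤ 3 * k)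
    (by simp [pairWeight]) P with h1 | ⟨A, hA, x, hx, hxA, h1, h2⟩
  · left; omega
  have hxAP : insert x A ⊆ P := Finset.insert_subset hx hA
  have hP : insert x A ∪ P \ insert x A = P := Finset.union_sdiff_of_subset hxAP
  have d : Disjoint (insert x A) (P \ insert x A) := Finset.disjoint_sdiff
  have hs := NoTwoPieces.split (c := c) (k := k) (Q := Q) d (by rwa [hP])
  rw [hP] at hs
  rcases hs with h3 | h3 | ⟨y, hy, h3⟩
  · exact absurd h3 h2
  · refine Or.inr (Or.inl ⟨x, hx, ?_⟩)
    have e1 := pairWeight.union_left c d Q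
    have e2 : pairWeight c (insert x A) Q = pairWeight c {x} Q + pairWeight c A Q :=
      pairWeight.union_left c (Finset.disjoint_singleton_left.2 hxA) Q
    rw [hP] at e1
    omega
  · exact Or.inr (Or.inr ⟨y, hy, by omega⟩)

/-- A weighted graph in which no two disjoint vertex sets both span more than `k` is, up to
`O(k)`, a star or a triangle, so that some vertex carries two thirds of the weight. -/
theorem exists_two_thirds_le_degree {ι : Type*} [Fintype ι] [DecidableEq ι] [Nonempty ι]
    {c : ι → ι → ℕ} {k : ℕ} (hc : ∀ a b, c a b = c b a) (hc0 : ∀ a, c a a = 0)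
    (h : ∀ A B : Finset ι, Disjoint A B →
      pairWeight c A A ≤ 2 * k ∨ pairWeight c B B ≤ 2 * k) :
    ∃ a, pairWeight c Finset.univ Finset.univ ≤
      3 * pairWeight c {a} Finset.univ + 28 * k := by
  have hs0 : ∀ a, pairWeight c {a} {a} = 0 := by simp [pairWeight, hc0]
  have hno : ∀ P Q, Disjoint P Q → NoTwoPieces c k P Q := by
    intro P Q hPQ P₁ hP₁ P₂ hP₂ Q₁ hQ₁ Q₂ hQ₂ hP hQ
    -- `pairWeight c A A` counts every edge twice, hence `2 * k` there against `k` for bipartite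
    -- pieces.
    have := h (P₁ ∪ Q₁) (P₂ ∪ Q₂) (by
      simp only [Finset.disjoint_union_left, Finset.disjoint_union_right]
      exact ⟨⟨hP, (hPQ.mono hP₂ hQ₁).symm⟩, hPQ.mono hP₁ hQ₂, hQ⟩)
    rw [pairWeight.union_union hc (hPQ.mono hP₁ hQ₁),
      pairWeight.union_union hc (hPQ.mono hP₂ hQ₂)] at this
    omega
  rcases Finset.exists_subset_insert_not (fun A => pairWeight c A A ≤ 2 * k)
    (by simp [pairWeight]) Finset.univ with h1 | ⟨A, -, v, -, hvA, h1, h2⟩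
  · obtain ⟨a⟩ := ‹Nonempty ι›
    exact ⟨a, by omega⟩
  set B := (insert v A)ᶜ with hB
  have dAB' : Disjoint (insert v A) B := disjoint_compl_right
  have dAB : Disjoint A B := dAB'.mono_left (Finset.subset_insert _ _)
  have dvA : Disjoint {v} A := Finset.disjoint_singleton_left.2 hvA
  have hvB : v ∉ B := by simp [hB]
  have h3 : pairWeight c B B ≤ 2 * k := (h _ _ dAB').resolve_left h2
  have huniv : ∀ x (Z : Finset ι), x ∉ Z → (∀ y, y ≠ x → y ∈ Z) →
      pairWeight c Finset.univ Finset.univ =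
        2 * pairWeight c {x} Finset.univ + pairWeight c Z Z ∧
      pairWeight c {x} Finset.univ = pairWeight c {x} Z := by
    intro x Z hx hZ
    have hU : Finset.univ = {x} ∪ Z := by
      ext y
      by_cases hy : y = x <;> simp [hy, hZ y]
    have d : Disjoint {x} Z := Finset.disjoint_singleton_left.2 hx
    have e2 : pairWeight c {x} Finset.univ = pairWeight c {x} Z := by
      rw [hU, pairWeight.union_right c _ d, hs0, zero_add]
    refine ⟨?_, e2⟩
    rw [e2, hU, pairWeight.union_union hc d, hs0]
    ring
  -- Away from `v` the weight lies mostly between `A` and `B`, where it is negligible or a star with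
  -- centre `u`; 16 = 2 + 2 + 2 · 6.
  have key : pairWeight c A B ≤ 6 * k ∨ ∃ u, u ≠ v ∧ ∀ Z : Finset ι, u ∉ Z → v ∉ Z →
      pairWeight c Z Z ≤ 16 * k := by
    have split : ∀ Z : Finset ι, v ∉ Z → pairWeight c Z Z =
        pairWeight c (Z ∩ A) (Z ∩ A) + pairWeight c (Z ∩ B) (Z ∩ B) +
          2 * pairWeight c (Z ∩ A) (Z ∩ B) := by
      intro Z hZ
      have : Z = (Z ∩ A) ∪ (Z ∩ B) := by
        ext y
        simp only [Finset.mem_union, Finset.mem_inter, hB, Finset.mem_compl, Finset.mem_insert]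
        constructor
        · intro hy
          by_cases hyA : y ∈ A
          · exact Or.inl ⟨hy, hyA⟩
          · refine Or.inr ⟨hy, ?_⟩
            rintro (rfl | h)
            exacts [hZ hy, hyA h]
        · tauto
      conv_lhs => rw [this]
      exact pairWeight.union_union hc
        (dAB.mono Finset.inter_subset_right Finset.inter_subset_right)
    rcases (hno A B dAB).star with h4 | ⟨u, hu, h4⟩ | ⟨u, hu, h4⟩
    · exact Or.inl h4
    · refine Or.inr ⟨u, fun e => hvA (e ▸ hu), fun Z huZ hvZ => ?_⟩
      have d : Disjoint {u} (Z ∩ A) := by simp [huZ]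
      have e1 := pairWeight.union_left c d B
      have e2 : pairWeight c ({u} ∪ Z ∩ A) B ≤ pairWeight c A B := pairWeight.mono c
        (Finset.union_subset (by simpa using hu) Finset.inter_subset_right) subset_rfl
      have e3 := pairWeight.mono c (subset_refl (Z ∩ A)) (Finset.inter_subset_right : Z ∩ B ⊆ B)
      have e4 := pairWeight.mono c (Finset.inter_subset_right : Z ∩ B ⊆ B)
        (Finset.inter_subset_right : Z ∩ B ⊆ B)
      have e5 := pairWeight.mono c (Finset.inter_subset_right : Z ∩ A ⊆ A)
        (Finset.inter_subset_right : Z ∩ A ⊆ A)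
      rw [split Z hvZ]
      omega
    · refine Or.inr ⟨u, fun e => hvB (e ▸ hu), fun Z huZ hvZ => ?_⟩
      have d : Disjoint {u} (Z ∩ B) := by simp [huZ]
      have e1 := pairWeight.union_right c A d
      have e2 : pairWeight c A ({u} ∪ Z ∩ B) ≤ pairWeight c A B := pairWeight.mono c
        subset_rfl (Finset.union_subset (by simpa using hu) Finset.inter_subset_right)
      have e3 := pairWeight.mono c (Finset.inter_subset_right : Z ∩ A ⊆ A) (subset_refl (Z ∩ B))
      have e4 := pairWeight.mono c (Finset.inter_subset_right : Z ∩ B ⊆ B)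
        (Finset.inter_subset_right : Z ∩ B ⊆ B)
      have e5 := pairWeight.mono c (Finset.inter_subset_right : Z ∩ A ⊆ A)
        (Finset.inter_subset_right : Z ∩ A ⊆ A)
      rw [split Z hvZ]
      omega
  rcases key with h4 | ⟨u, huv, hZ⟩
  · refine ⟨v, ?_⟩
    have e1 := (huniv v (A ∪ B) (by simp [hvA, hvB]) (by
      intro y hy
      by_cases hyA : y ∈ A <;> simp [hB, hyA, hy])).1
    rw [pairWeight.union_union hc dAB] at e1
    omega
  set Z : Finset ι := {u, v}ᶜ with hZdef
  have huZ : u ∉ Z := by simp [hZdef]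
  have hvZ : v ∉ Z := by simp [hZdef]
  have h5 := hZ Z huZ hvZ
  have duv : Disjoint ({u} : Finset ι) {v} := by simpa using huv
  have duZ : Disjoint {u} Z := by simp [huZ]
  have dvZ : Disjoint {v} Z := by simp [hvZ]
  have dZ : Disjoint ({u} ∪ {v}) Z := by simp [huZ, hvZ]
  have hU : Finset.univ = ({u} ∪ {v}) ∪ Z := by
    ext y
    by_cases h1 : y = u <;> by_cases h2 : y = v <;> simp [hZdef, h1, h2]
  have f0 : ∀ x, pairWeight c {x} Finset.univ =
      pairWeight c {x} {u} + pairWeight c {x} {v} + pairWeight c {x} Z := by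
    intro x
    rw [hU, pairWeight.union_right c _ dZ, pairWeight.union_right c _ duv]
  have f1 := f0 u
  have f2 := f0 v
  have f3 : pairWeight c Finset.univ Finset.univ = pairWeight c Z Z + 2 * pairWeight c {u} Z +
      2 * pairWeight c {v} Z + 2 * pairWeight c {u} {v} := by
    rw [hU, pairWeight.union_union hc dZ, pairWeight.union_union hc duv, hs0, hs0,
      pairWeight.union_left c duv]
    ring
  have f4 := pairWeight.symm hc {u} {v}
  have f5 := hs0 u
  have f6 := hs0 v
  have f7 := pairWeight.union_left c duv Z
  -- Here 28 = 16 + 2 · 6. A centre `y` in `Z` is the triangle case: up to `28 * k`, the total is at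
  -- most the sum of the degrees of `u`, `v` and `y`.
  rcases (hno _ _ dZ).star with h6 | ⟨x, hx, h6⟩ | ⟨y, hy, h6⟩
  · exact ⟨u, by omega⟩
  · rcases Finset.mem_union.1 hx with hx | hx <;> rw [Finset.mem_singleton] at hx <;> subst hx
    · exact ⟨x, by omega⟩
    · exact ⟨x, by omega⟩
  · have g0 := f0 y
    have g1 := pairWeight.union_left c duv {y}
    have g2 := pairWeight.symm hc {y} {u}
    have g3 := pairWeight.symm hc {y} {v}
    have g4 := pairWeight.mono c (subset_refl {u}) (Finset.singleton_subset_iff.2 hy)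
    have g5 := pairWeight.mono c (subset_refl {v}) (Finset.singleton_subset_iff.2 hy)
    by_contra! hcon
    have c1 := hcon u
    have c2 := hcon v
    have c3 := hcon y
    omega

/-! ### Labellings and the degrees of elements in their classes -/

/-- The sum of `⌊|C| / 2⌋` over the classes `C` of a labelling, that is, the matching number of
the disjoint union of the complete graphs on the classes. -/
def classMatching {U K : Type*} [Fintype U] [Fintype K] [DecidableEq K] (f : U → K) : ℕ :=
  ∑ x, (Finset.univ.filter fun u => f u = x).card / 2

section Cover

variable {U K : Type*} [Fintype U] [Fintype K] [DecidableEq K] {q : ℕ} (f : Fin q → U → K)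

/-- The class of the `i.1`-th labelling with label `i.2`. -/
def labelClass (i : Fin q × K) : Finset U := Finset.univ.filter fun u => f i.1 u = i.2

/-- The classes with at least two elements that contain `u`. -/
def classesAt (u : U) : Finset (Fin q × K) :=
  Finset.univ.filter fun i => f i.1 u = i.2 ∧ 2 ≤ (labelClass f i).card

variable {f}

lemma mem_classesAt {u : U} {i : Fin q × K} :
    i ∈ classesAt f u ↔ u ∈ labelClass f i ∧ 2 ≤ (labelClass f i).card := by
  rw [classesAt, Finset.mem_filter]
  simp [labelClass]

lemma exists_mem_classesAt {x y : U} (hxy : x ≠ y) {j : Fin q} (h : f j x = f j y) :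
    ∃ i, i ∈ classesAt f x ∧ i ∈ classesAt f y := by
  refine ⟨(j, f j x), ?_⟩
  have hx : x ∈ labelClass f (j, f j x) := by simp [labelClass]
  have hy : y ∈ labelClass f (j, f j x) := by simp [labelClass, h]
  have : 2 ≤ (labelClass f (j, f j x)).card := Finset.one_lt_card.2 ⟨x, hx, y, hy, hxy⟩
  exact ⟨mem_classesAt.2 ⟨hx, this⟩, mem_classesAt.2 ⟨hy, this⟩⟩

lemma half_card_labelClass_le (i : Fin q × K) :
    (labelClass f i).card / 2 ≤ classMatching (f i.1) :=
  Finset.single_le_sum (f := fun x => (Finset.univ.filter fun u => f i.1 u = x).card / 2)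
    (fun _ _ => Nat.zero_le _) (Finset.mem_univ i.2)

lemma sum_card_classesAt_le :
    ∑ u, (classesAt f u).card ≤ 3 * ∑ j, classMatching (f j) := by
  have h1 : ∑ u, (classesAt f u).card =
      ∑ i : Fin q × K, (Finset.univ.filter fun u => i ∈ classesAt f u).card := by
    simp only [Finset.card_eq_sum_ones, Finset.sum_filter]
    rw [Finset.sum_comm]
    refine Finset.sum_congr rfl fun u _ => ?_
    rw [← Finset.sum_filter]
    simp
  rw [h1, Fintype.sum_prod_type, Finset.mul_sum]
  refine Finset.sum_le_sum fun j _ => ?_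
  rw [classMatching, Finset.mul_sum]
  refine Finset.sum_le_sum fun x _ => ?_
  by_cases h : 2 ≤ (labelClass f (j, x)).card
  · have : (Finset.univ.filter fun u => (j, x) ∈ classesAt f u) = labelClass f (j, x) := by
      ext u
      simp [mem_classesAt, h]
    rw [this]
    change _ ≤ 3 * ((labelClass f (j, x)).card / 2)
    omega
  · have : (Finset.univ.filter fun u => (j, x) ∈ classesAt f u) = ∅ := by
      ext u
      simp [mem_classesAt, h]
    simp [this]

/-- The number of elements of `D` contained in two given classes. -/
def commonCount (D : Finset U) (f : Fin q → U → K) (i i' : Fin q × K) : ℕ :=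
  if i = i' then 0 else (D.filter fun u => i ∈ classesAt f u ∧ i' ∈ classesAt f u).card

lemma pairWeight_commonCount [DecidableEq U] (D : Finset U) (A B : Finset (Fin q × K)) :
    pairWeight (commonCount D f) A B =
      ∑ u ∈ D, (((A ∩ classesAt f u) ×ˢ (B ∩ classesAt f u)).filter fun p => p.1 ≠ p.2).card := by
  have : ∀ u, (((A ∩ classesAt f u) ×ˢ (B ∩ classesAt f u)).filter fun p => p.1 ≠ p.2).card =
      ∑ a ∈ A, ∑ b ∈ B, if a ≠ b ∧ a ∈ classesAt f u ∧ b ∈ classesAt f u then 1 else 0 := by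
    intro u
    rw [← Finset.sum_product', ← Finset.sum_filter, ← Finset.card_eq_sum_ones]
    congr 1
    ext p
    simp only [Finset.mem_filter, Finset.mem_product, Finset.mem_inter]
    tauto
  have hcount : ∀ a b, commonCount D f a b =
      ∑ u ∈ D, if a ≠ b ∧ a ∈ classesAt f u ∧ b ∈ classesAt f u then 1 else 0 := by
    intro a b
    by_cases h : a = b <;> simp [commonCount, h]
  simp only [this, pairWeight, hcount]
  exact (Finset.sum_congr rfl fun a _ => Finset.sum_comm).trans Finset.sum_comm

lemma pairWeight_commonCount_self [DecidableEq U] (D : Finset U) (A : Finset (Fin q × K)) :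
    pairWeight (commonCount D f) A A = ∑ u ∈ D, (A ∩ classesAt f u).offDiag.card := by
  rw [pairWeight_commonCount]
  refine Finset.sum_congr rfl fun u _ => congrArg Finset.card ?_
  ext p
  simp only [Finset.mem_filter, Finset.mem_product, Finset.mem_offDiag, and_assoc]

end Cover

/-- If `q` labellings of a set are such that any two disjoint sets of more than `k` elements share
a label, then the matching numbers of the labellings are large. -/
theorem card_le_sum_classMatching {U K : Type*} [Fintype U] [Fintype K] [DecidableEq K]
    {q k : ℕ} (hq : 0 < q) (f : Fin q → U → K)
    (h : ∀ X Y : Finset U, Disjoint X Y → k + 1 ≤ X.card → k + 1 ≤ Y.card →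
      ∃ x ∈ X, ∃ y ∈ Y, ∃ j, f j x = f j y) :
    ∃ i, Fintype.card U ≤ ∑ j, classMatching (f j) + classMatching (f i) + 9 * k + 1 := by
  classical
  have hmeet : ∀ X Y : Finset U, Disjoint X Y → k + 1 ≤ X.card → k + 1 ≤ Y.card →
      ∃ x ∈ X, ∃ y ∈ Y, ∃ i, i ∈ classesAt f x ∧ i ∈ classesAt f y := by
    intro X Y hXY hX hY
    obtain ⟨x, hx, y, hy, j, hj⟩ := h X Y hXY hX hY
    exact ⟨x, hx, y, hy, exists_mem_classesAt (fun e => Finset.disjoint_left.1 hXY hx (e ▸ hy)) hj⟩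
  rcases isEmpty_or_nonempty U with hU | ⟨⟨u₀⟩⟩
  · exact ⟨⟨0, hq⟩, by simp⟩
  have : Nonempty (Fin q × K) := ⟨(⟨0, hq⟩, f ⟨0, hq⟩ u₀)⟩
  set D : ℕ → Finset U := fun d => Finset.univ.filter fun u => (classesAt f u).card = d with hD
  -- Elements whose classes all lie in `I` share none with elements whose classes all lie in `J`.
  have hin : ∀ d (I J : Finset (Fin q × K)), 0 < d → Disjoint I J →
      ((D d).filter fun u => classesAt f u ⊆ I).card ≤ k ∨
      ((D d).filter fun u => classesAt f u ⊆ J).card ≤ k := by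
    intro d I J hd hIJ
    by_contra! hcon
    obtain ⟨x, hx, y, hy, i, hi, hi'⟩ := hmeet _ _ (by
      rw [Finset.disjoint_left]
      intro u hu hu'
      simp only [Finset.mem_filter, hD, Finset.mem_univ, true_and] at hu hu'
      have : (classesAt f u).Nonempty := Finset.card_pos.1 (by omega)
      obtain ⟨i, hi⟩ := this
      exact Finset.disjoint_left.1 hIJ (hu.2 hi) (hu'.2 hi)) hcon.1 hcon.2
    exact Finset.disjoint_left.1 hIJ ((Finset.mem_filter.1 hx).2 hi) ((Finset.mem_filter.1 hy).2 hi')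
  have hD0 : (D 0).card ≤ k ∨ Fintype.card U ≤ 2 * k + 1 := by
    by_contra! hcon
    obtain ⟨X, hX, hXc⟩ := Finset.exists_subset_card_eq (show k + 1 ≤ (D 0).card by omega)
    obtain ⟨x, hx, y, hy, i, hi, hi'⟩ := hmeet X Xᶜ disjoint_compl_right (by omega)
      (by rw [Finset.card_compl]; omega)
    have := hX hx
    simp only [Finset.mem_filter, hD, Finset.mem_univ, true_and, Finset.card_eq_zero] at this
    simp [this] at hi
  rcases hD0 with hD0 | hsmall
  swap
  · exact ⟨⟨0, hq⟩, by omega⟩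
  by_cases hbig : ∃ i, k + 1 ≤ ((D 1).filter fun u => i ∈ classesAt f u).card
  · obtain ⟨i, hi⟩ := hbig
    -- Elements of degree 1 in class `i` can share a class only with members of class `i`.
    have hc : (labelClass f i)ᶜ.card ≤ k := by
      by_contra! hcon
      obtain ⟨x, hx, y, hy, i', hi', hi''⟩ := hmeet _ _ (by
        rw [Finset.disjoint_left]
        intro u hu hu'
        exact Finset.mem_compl.1 hu' (mem_classesAt.1 (Finset.mem_filter.1 hu).2).1) hi hcon
      simp only [Finset.mem_filter, hD, Finset.mem_univ, true_and] at hx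
      obtain ⟨i₁, h1⟩ := Finset.card_eq_one.1 hx.1
      rw [h1, Finset.mem_singleton] at hx hi'
      rw [hi', ← hx.2] at hi''
      exact Finset.mem_compl.1 hy (mem_classesAt.1 hi'').1
    rw [Finset.card_compl] at hc
    have h1 := half_card_labelClass_le (f := f) i
    have h2 : classMatching (f i.1) ≤ ∑ j, classMatching (f j) :=
      Finset.single_le_sum (f := fun j => classMatching (f j)) (fun _ _ => Nat.zero_le _)
        (Finset.mem_univ i.1)
    exact ⟨i.1, by omega⟩
  push Not at hbig
  -- Add classes until more than `k` elements of degree 1 are covered: at most `k` came before the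
  -- last class `i`, `k` lie in it and `k` remain.
  have hD1 : (D 1).card ≤ 3 * k := by
    rcases Finset.exists_subset_insert_not
      (fun I => ((D 1).filter fun u => classesAt f u ⊆ I).card ≤ k) (by
        have : ((D 1).filter fun u => classesAt f u ⊆ ∅) = ∅ := by
          ext u
          simp only [hD, Finset.mem_filter, Finset.mem_univ, true_and, Finset.subset_empty,
            Finset.notMem_empty, iff_false, not_and]
          intro h1 h2
          simp [h2] at h1
        rw [this]; simp) (Finset.univ : Finset (Fin q × K)) with h1 | ⟨I, -, i, -, -, h1, h2⟩
    · simp at h1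
      omega
    · have h3 := (hin 1 _ _ one_pos (disjoint_compl_right (a := insert i I))).resolve_left h2
      have h4 : D 1 ⊆ (((D 1).filter fun u => classesAt f u ⊆ I) ∪
          ((D 1).filter fun u => classesAt f u ⊆ (insert i I)ᶜ)) ∪
          ((D 1).filter fun u => i ∈ classesAt f u) := by
        intro u hu
        simp only [Finset.mem_union, Finset.mem_filter, hu, true_and]
        obtain ⟨i', hi'⟩ := Finset.card_eq_one.1 (Finset.mem_filter.1 hu).2
        simp only [hi', Finset.singleton_subset_iff, Finset.mem_compl, Finset.mem_insert,
          Finset.mem_singleton]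
        tauto
      have h5 := Finset.card_le_card h4
      have h6 := Finset.card_union_le (((D 1).filter fun u => classesAt f u ⊆ I) ∪
          ((D 1).filter fun u => classesAt f u ⊆ (insert i I)ᶜ))
          ((D 1).filter fun u => i ∈ classesAt f u)
      have h7 := Finset.card_union_le ((D 1).filter fun u => classesAt f u ⊆ I)
          ((D 1).filter fun u => classesAt f u ⊆ (insert i I)ᶜ)
      have h8 := hbig i
      omega
  -- Each element of `D 2` is an edge joining its two classes, so the degree of `i` is at most the
  -- size of its class.
  have hD2 : ∃ i, 2 * (D 2).card ≤ 3 * (labelClass f i).card + 28 * k := by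
    obtain ⟨i, hi⟩ := exists_two_thirds_le_degree (c := commonCount (D 2) f) (k := k)
      (by intro a b; simp only [commonCount, eq_comm (a := a), and_comm])
      (by simp [commonCount])
      (by
        have key : ∀ A, pairWeight (commonCount (D 2) f) A A ≤
            2 * ((D 2).filter fun u => classesAt f u ⊆ A).card := by
          intro A
          rw [pairWeight_commonCount_self, Finset.card_filter, Finset.mul_sum]
          refine Finset.sum_le_sum fun u hu => ?_
          have hu2 : (classesAt f u).card = 2 := (Finset.mem_filter.1 hu).2
          rw [Finset.offDiag_card]
          split_ifs with hA
          · simp [Finset.inter_eq_right.2 hA, hu2]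
          · have : (A ∩ classesAt f u).card < 2 := by
              rw [← hu2]
              refine Finset.card_lt_card ⟨Finset.inter_subset_right, fun hs => hA ?_⟩
              exact hs.trans Finset.inter_subset_left
            interval_cases (A ∩ classesAt f u).card <;> simp
        intro A B hAB
        rcases hin 2 A B two_pos hAB with h1 | h1
        · exact Or.inl ((key A).trans (by omega))
        · exact Or.inr ((key B).trans (by omega)))
    refine ⟨i, ?_⟩
    have e1 : pairWeight (commonCount (D 2) f) Finset.univ Finset.univ = 2 * (D 2).card := by
      rw [pairWeight_commonCount_self, mul_comm, ← smul_eq_mul, ← Finset.sum_const]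
      refine Finset.sum_congr rfl fun u hu => ?_
      have hu2 : (classesAt f u).card = 2 := (Finset.mem_filter.1 hu).2
      rw [Finset.univ_inter, Finset.offDiag_card, hu2]
    have e2 : pairWeight (commonCount (D 2) f) {i} Finset.univ ≤ (labelClass f i).card := by
      rw [pairWeight_commonCount]
      calc _ ≤ ∑ u ∈ D 2, if i ∈ classesAt f u then 1 else 0 := by
            refine Finset.sum_le_sum fun u hu => ?_
            have hu2 : (classesAt f u).card = 2 := (Finset.mem_filter.1 hu).2
            rw [Finset.univ_inter]
            split_ifs with hi'
            · have : (({i} ∩ classesAt f u) ×ˢ classesAt f u).filter (fun p => p.1 ≠ p.2) ⊆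
                  {i} ×ˢ (classesAt f u).erase i := by
                intro p
                simp only [Finset.mem_filter, Finset.mem_product, Finset.mem_inter,
                  Finset.mem_singleton, Finset.mem_erase]
                rintro ⟨⟨⟨h1, h2⟩, h3⟩, h4⟩
                exact ⟨h1, fun e => h4 (h1.trans e.symm), h3⟩
              refine (Finset.card_le_card this).trans ?_
              rw [Finset.card_product, Finset.card_erase_of_mem hi', hu2]
              simp
            · rw [Finset.singleton_inter_of_notMem hi']
              simp
        _ = ((D 2).filter fun u => i ∈ classesAt f u).card := (Finset.card_filter _ _).symm
        _ ≤ _ := Finset.card_le_card fun u hu => (mem_classesAt.1 (Finset.mem_filter.1 hu).2).1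
    omega
  obtain ⟨i, hi⟩ := hD2
  refine ⟨i.1, ?_⟩
  have h1 := half_card_labelClass_le (f := f) i
  have h2 := sum_card_classesAt_le (f := f)
  -- Degree 2 falls short of 3 by one, degrees 0 and 1 by at most three. The error in `k` is then
  -- (14 + 9 + 3)/3 ≤ 9.
  have h3 : 3 * Fintype.card U ≤
      ∑ u, (classesAt f u).card + (D 2).card + 3 * (D 1).card + 3 * (D 0).card := by
    simp only [hD, Finset.card_filter, Finset.mul_sum, ← Finset.sum_add_distrib]
    rw [mul_comm, ← smul_eq_mul, ← Finset.card_univ, ← Finset.sum_const]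
    refine Finset.sum_le_sum fun u _ => ?_
    split_ifs <;> omega
  omega

/-! ### The Ramsey statement -/

theorem lemma3p10 (q s : ℕ) (hq : 1 ≤ q) (hs : 1 ≤ s)
    (z : Fin q → ℕ) (hz_min : s - 1 ≤ vecMin z)
    (hz_sum : (q + 13) * (s - 1) ≤ vecNormOne z + vecMin z)
    (t : Fin q → ℕ) (ht : ∀ j, 0 < t j)
    (n : ℕ) (hn : vecNormInf t + vecLambda t + 1 ≤ n)
    {V : Type*} [Fintype V] (hV : Fintype.card V = n)
    (G : SimpleGraph V) (hG : IsConnector G s) :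
    RamseyArrows G
      (fun j => matchingGraph (vecPosPart (fun i => (t i : ℤ) - (z i : ℤ)) j)) := by

  classical
  intro c
  by_contra hne
  have hm : ∀ j, vecPosPart (fun i => (t i : ℤ) - (z i : ℤ)) j = t j - z j := by
    intro j
    simp only [vecPosPart]
    omega
  have hcon : ∀ j, ¬ (matchingGraph (t j - z j)).IsContained (c.labelGraph j) :=
    fun j h => hne ⟨j, by beta_reduce; rwa [hm]⟩
  -- If `t j ≤ z j`, the required matching is empty and lies in every graph.
  have hpos : ∀ j, 0 < t j - z j := by
    intro j
    by_contra h0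
    have h0' : t j - z j = 0 := by omega
    have : IsEmpty (Fin (t j - z j) × Fin 2) := by
      rw [h0']
      infer_instance
    exact hcon j (SimpleGraph.IsContained.of_isEmpty)
  choose S f hf hS using fun j =>
    exists_label_of_not_matchingGraph_isContained (c.labelGraph j) _ (hpos j) (hcon j)
  set T : Finset V := Finset.univ.biUnion S with hT
  have hTS : ∀ v, v ∉ T → ∀ j, v ∉ S j := fun v hv j h =>
    hv (Finset.mem_biUnion.2 ⟨j, Finset.mem_univ j, h⟩)
  obtain ⟨i, hi⟩ := card_le_sum_classMatching (U := {v // v ∉ T}) (k := s - 1) hq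
    (fun j u => f j u) (by
      intro X Y hXY hX hY
      obtain ⟨x, hx, y, hy, hxy⟩ := hG (X.map (Function.Embedding.subtype _))
        (Y.map (Function.Embedding.subtype _)) (Finset.disjoint_map _ |>.2 hXY)
        (by rw [Finset.card_map]; omega) (by rw [Finset.card_map]; omega)
      obtain ⟨x, hx', rfl⟩ := Finset.mem_map.1 hx
      obtain ⟨y, hy', rfl⟩ := Finset.mem_map.1 hy
      exact ⟨x, hx', y, hy', c ⟨s(_, _), hxy⟩, hf _ _ _ (hTS _ x.2 _) (hTS _ y.2 _)
        ((SimpleGraph.EdgeLabeling.labelGraph_adj _ _).2 ⟨hxy, rfl⟩)⟩)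
  have hle : ∀ j, classMatching (fun u : {v // v ∉ T} => f j u) ≤
      ∑ x, (Finset.univ.filter fun v => v ∉ S j ∧ f j v = x).card / 2 := by
    intro j
    refine Finset.sum_le_sum fun x _ => Nat.div_le_div_right ?_
    refine Finset.card_le_card_of_injOn Subtype.val (fun u hu => ?_) Subtype.val_injective.injOn
    simp only [Finset.coe_filter, Finset.mem_univ, true_and, Set.mem_ofPred_eq] at hu ⊢
    exact ⟨hTS _ u.2 j, hu⟩
  have hcardU : Fintype.card V = Fintype.card {v // v ∉ T} + T.card := by
    rw [Fintype.card_subtype_compl, Fintype.card_coe, Nat.sub_add_cancel (Finset.card_le_univ _)]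
  have hTcard : T.card ≤ ∑ j, (S j).card := Finset.card_biUnion_le
  have hti : t i ≤ vecNormInf t := Finset.le_sup (f := t) (Finset.mem_univ i)
  have hzi : vecMin z ≤ z i := ciInf_le (OrderBot.bddBelow _) i
  -- The strict Tutte–Berge bound supplies the -1 in each summand `t j - 1`.
  have hΛ : ∑ j, ((S j).card + classMatching (fun u : {v // v ∉ T} => f j u) + z j) ≤
      vecLambda t := by
    refine Finset.sum_le_sum fun j _ => ?_
    have h1 := hle j
    have h2 := hS j
    omega
  rw [Finset.sum_add_distrib, Finset.sum_add_distrib] at hΛ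
  have hk : 9 * (s - 1) ≤ (q + 13) * (s - 1) := Nat.mul_le_mul_right _ (by omega)
  have h1 := hle i
  have h2 := hS i
  rw [vecNormOne] at hz_sum
  omega
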